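/- An affine isometric action of a group $G$ on a (real or complex) Hilbert space $\mathcal H$ is a homomorphism $\alpha$ from $G$ to the group of affine isometries of $\mathcal H$. Write $\alpha(g)v=\pi(g)v+b(g)$, where $\pi$ is an orthogonal or unitary representation (the linear part) and $b(g)=\alpha(g)0$. The action $\alpha$ is reducible if there is a non-empty, closed, proper affine subspace of $\mathcal H$ that is invariant under $\alpha(G)$, and irreducible otherwise. If $V\subseteq\mathcal H$ is a closed $\pi(G)$-invariant linear subspace and $P_V$ is the orthogonal projection onto $V$, the projected action of $\alpha$ on $V$ is the affine isometric action $v\mapsto \pi(g)v+P_V b(g)$ of $G$ on $V$. Two affine isometric actions $\alpha,\beta$ of $G$ on $\mathcal H,\mathcal K$ are equivalent if there is an invertible continuous affine map $A:\mathcal H\to\mathcal K$ (not necessarily isometric) with $A\alpha(g)=\beta(g)A$ for all $g\in G$. The direct sum $\alpha_1\oplus\alpha_2$ is the action $(v_1,v_2)\mapsto(\alpha_1(g)v_1,\alpha_2(g)v_2)$ on the Hilbert space $\mathcal H_1\oplus\mathcal H_2$. **Theorem.** Let $\alpha_1,\alpha_2$ be irreducible affine isometric actions of a group $G$ on Hilbert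 spaces $\mathcal H_1,\mathcal H_2$, both real or both complex. The following are equivalent: 1. $\alpha_1\oplus\alpha_2$ is reducible; 2. $\alpha_1$ and $\alpha_2$ admit equivalent projected actions, that is, there are non-zero closed linear subspaces $V_1\subseteq\mathcal H_1$ and $V_2\subseteq\mathcal H_2$, invariant under the linear parts of $\alpha_1$ and $\alpha_2$ respectively, such that the projected actions of $\alpha_1$ on $V_1$ and of $\alpha_2$ on $V_2$ are equivalent. -/

import Mathlib

noncomputable section

/-- Affine isometric actions of the group `G` on `H`: homomorphisms from `G` to the group of affine
isometries of `H`. -/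
abbrev AffineIsometricAction (𝕜 G H : Type*) [RCLike 𝕜] [Group G] [NormedAddCommGroup H]
    [InnerProductSpace 𝕜 H] : Type _ :=
  G →* (H ≃ᵃⁱ[𝕜] H)

namespace AffineIsometricAction

variable {𝕜 G H H₁ H₂ : Type*} [RCLike 𝕜] [Group G]
  [NormedAddCommGroup H] [InnerProductSpace 𝕜 H]
  [NormedAddCommGroup H₁] [InnerProductSpace 𝕜 H₁]
  [NormedAddCommGroup H₂] [InnerProductSpace 𝕜 H₂]

/-- The action is irreducible if the only nonempty closed invariant affine subspace is the
whole space. -/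
def IsIrreducible (α : AffineIsometricAction 𝕜 G H) : Prop :=
  ∀ W : AffineSubspace 𝕜 H, (W : Set H).Nonempty → IsClosed (W : Set H) →
    (∀ g : G, ∀ v ∈ W, α g v ∈ W) → W = ⊤

/-- The action is reducible if there is a nonempty, closed, proper, invariant affine subspace. -/
def IsReducible (α : AffineIsometricAction 𝕜 G H) : Prop :=
  ∃ W : AffineSubspace 𝕜 H, (W : Set H).Nonempty ∧ IsClosed (W : Set H) ∧ W ≠ ⊤ ∧
    ∀ g : G, ∀ v ∈ W, α g v ∈ W

theorem isReducible_iff_not_isIrreducible (α : AffineIsometricAction 𝕜 G H) :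
    IsReducible α ↔ ¬ IsIrreducible α := by
  unfold IsReducible IsIrreducible
  push Not
  exact exists_congr fun W => by tauto

/-- Two affine isometric actions are equivalent if they are intertwined by an invertible continuous
affine map (not necessarily isometric). -/
def Equivalent (α₁ : AffineIsometricAction 𝕜 G H₁) (α₂ : AffineIsometricAction 𝕜 G H₂) : Prop :=
  ∃ A : H₁ ≃ᴬ[𝕜] H₂, ∀ (g : G) (v : H₁), A (α₁ g v) = α₂ g (A v)

/-- The linear part `π` of the action `α(g)v = π(g)v + b(g)`. -/
def linearPart (α : AffineIsometricAction 𝕜 G H) : G →* (H ≃ₗᵢ[𝕜] H) where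
  toFun g := (α g).linearIsometryEquiv
  map_one' := by rw [map_one]; rfl
  map_mul' g h := by rw [map_mul]; rfl

/-- The translation part `b` of the action `α(g)v = π(g)v + b(g)`. -/
def translationPart (α : AffineIsometricAction 𝕜 G H) (g : G) : H := α g 0

theorem apply_eq (α : AffineIsometricAction 𝕜 G H) (g : G) (v : H) :
    α g v = linearPart α g v + translationPart α g := by
  simpa [linearPart, translationPart] using (α g).map_vadd 0 v

theorem translationPart_mul (α : AffineIsometricAction 𝕜 G H) (g h : G) :
    translationPart α (g * h) = linearPart α g (translationPart α h) + translationPart α g := by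
  rw [← apply_eq, translationPart, map_mul]; rfl

/-- The affine isometric action `α(g)v = π(g)v + b(g)` attached to an orthogonal or unitary
representation `π` and a 1-cocycle `b` for `π`. -/
def ofCocycle (π : G →* (H ≃ₗᵢ[𝕜] H)) (b : G → H)
    (hb : ∀ g h, b (g * h) = π g (b h) + b g) : AffineIsometricAction 𝕜 G H where
  toFun g := (π g).toAffineIsometryEquiv.trans (AffineIsometryEquiv.constVAdd 𝕜 H (b g))
  map_one' := by
    have h1 : b 1 = 0 := by simpa using hb 1 1
    ext v
    simp [h1]
  map_mul' g h := by
    ext v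
    simp only [AffineIsometryEquiv.coe_mul, AffineIsometryEquiv.coe_trans, Function.comp_apply,
      AffineIsometryEquiv.coe_constVAdd, LinearIsometryEquiv.coe_toAffineIsometryEquiv,
      vadd_eq_add, map_mul, LinearIsometryEquiv.coe_mul, hb, map_add]
    abel

theorem ofCocycle_apply (π : G →* (H ≃ₗᵢ[𝕜] H)) (b : G → H)
    (hb : ∀ g h, b (g * h) = π g (b h) + b g) (g : G) (v : H) :
    ofCocycle π b hb g v = π g v + b g := by
  simp [ofCocycle, add_comm]

/-- The direct sum `α₁ ⊕ α₂` on the Hilbert direct sum `H₁ ⊕ H₂`. -/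
def directSum (α₁ : AffineIsometricAction 𝕜 G H₁) (α₂ : AffineIsometricAction 𝕜 G H₂) :
    AffineIsometricAction 𝕜 G (WithLp 2 (H₁ × H₂)) :=
  ofCocycle
    { toFun := fun g =>
        LinearIsometryEquiv.withLpProdCongr 2 (linearPart α₁ g) (linearPart α₂ g)
      map_one' := by rw [map_one, map_one]; rfl
      map_mul' := fun g h => by rw [map_mul, map_mul]; rfl }
    (fun g => WithLp.toLp 2 (translationPart α₁ g, translationPart α₂ g))
    (fun g h => by rw [translationPart_mul, translationPart_mul]; rfl)

theorem directSum_apply (α₁ : AffineIsometricAction 𝕜 G H₁) (α₂ : AffineIsometricAction 𝕜 G H₂)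
    (g : G) (x : WithLp 2 (H₁ × H₂)) :
    directSum α₁ α₂ g x = WithLp.toLp 2 (α₁ g x.fst, α₂ g x.snd) := by
  rw [directSum, ofCocycle_apply, apply_eq α₁, apply_eq α₂]; rfl

/-- Subrepresentations of the linear part of `α`: closed linear subspaces that are invariant under
the linear part. -/
structure Subrep (α : AffineIsometricAction 𝕜 G H) where
  carrier : Submodule 𝕜 H
  isClosed : IsClosed (carrier : Set H)
  invariant : ∀ g : G, ∀ v ∈ carrier, linearPart α g v ∈ carrier

namespace Subrep

variable {α : AffineIsometricAction 𝕜 G H}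

instance [CompleteSpace H] (V : Subrep α) : CompleteSpace V.carrier :=
  V.isClosed.completeSpace_coe

/-- The restriction of the linear part of `α` to the subspace. -/
def rep (V : Subrep α) : G →* (V.carrier ≃ₗᵢ[𝕜] V.carrier) where
  toFun g :=
    { toFun := fun v => ⟨linearPart α g v, V.invariant g v v.2⟩
      invFun := fun v => ⟨linearPart α g⁻¹ v, V.invariant g⁻¹ v v.2⟩
      left_inv := fun v => Subtype.ext (by simp)
      right_inv := fun v => Subtype.ext (by simp)
      map_add' := fun v w => Subtype.ext (by simp)
      map_smul' := fun c v => Subtype.ext (by simp)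
      norm_map' := fun v => (linearPart α g).norm_map v }
  map_one' := by ext v; simp
  map_mul' g h := by ext v; simp

theorem coe_rep_apply (V : Subrep α) (g : G) (v : V.carrier) :
    (V.rep g v : H) = linearPart α g v := rfl

/-- The orthogonal projection onto a subrepresentation commutes with the linear part. -/
theorem orthogonalProjection_linearPart [CompleteSpace H] (V : Subrep α) (g : G) (x : H) :
    V.carrier.orthogonalProjectionOnto (linearPart α g x) =
      V.rep g (V.carrier.orthogonalProjectionOnto x) := by
  apply Subtype.ext
  refine V.carrier.eq_starProjection_of_mem_of_inner_eq_zero (V.rep g _).2 fun w hw => ?_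
  have h := V.carrier.starProjection_inner_eq_zero x _ (V.invariant g⁻¹ w hw)
  rw [← (linearPart α g).inner_map_map] at h
  simpa [coe_rep_apply] using h

/-- The projected action of `α` on a subrepresentation `V`: its linear part is the restriction
to `V` of the linear part of `α`, and its translation part is the orthogonal projection onto `V`
of the translation part of `α`. -/
def projectedAction [CompleteSpace H] (V : Subrep α) : AffineIsometricAction 𝕜 G V.carrier :=
  ofCocycle V.rep (fun g => V.carrier.orthogonalProjectionOnto (translationPart α g))
    (fun g h => by rw [translationPart_mul, map_add, orthogonalProjection_linearPart])

end Subrep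

end AffineIsometricAction

end

/-! ### Convex real sequences. -/

section ConvexSequence

/-! Given an equivalence `A` of projected actions, the locus `A (P₁ x₁) = P₂ x₂` is a closed,
proper, invariant affine subspace of the sum.

Conversely, let `W` be such a subspace and `U` the orthogonal complement of its direction, a nonzero
subrepresentation. Irreducibility makes both projections of `W` dense, so the coordinate maps `p₁`,
`p₂` are injective on `U`. If both were bounded below, their ranges would be closed
subrepresentations, and the equations `⟪w, u⟫ = const` cutting out `W` would express one projected
action through the other by an invertible affine map (`equivalent_projectedAction`).

In general one first shrinks `U` to an invariant subspace `K` on which both are bounded below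
(`exists_submodule_bounded_below`). A spectral subspace of `p₁† p₁` away from 0 and 1 would serve;
here it is obtained without spectral calculus. For a positive operator `A`, the vectors with bounded
`A`-orbit form the spectral subspace of `[0, 1]`, and `powBounded_ne_bot` shows that it is nonzero
as soon as `⟪A v, v⟫ < ‖v‖²` for some `v`. The estimates all rest on the convexity of `k ↦ ⟪A ^ k w,
w⟫`. -/

theorem monotone_diff_of_convex {m : ℕ → ℝ} (hm : ∀ k, 0 ≤ m (k + 2) - 2 * m (k + 1) + m k) :
    Monotone fun k => m (k + 1) - m k :=
  monotone_nat_of_le_succ fun k => by linarith [hm k]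

theorem le_max_of_convex {m : ℕ → ℝ} (hm : ∀ k, 0 ≤ m (k + 2) - 2 * m (k + 1) + m k)
    {a b : ℕ} (hab : a ≤ b) : m a ≤ max (m 0) (m b) := by
  have hd := monotone_diff_of_convex hm
  induction b, hab using Nat.le_induction with
  | base => exact le_max_right _ _
  | succ b hab ih =>
    rcases le_or_gt 0 (m (b + 1) - m b) with h | h
    · exact ih.trans (max_le_max le_rfl (by linarith))
    -- Differences increase, so a negative last step forces every earlier step to be negative.
    · have key : ∀ j, j ≤ b → m j ≤ m 0 := by
        intro j
        induction j with
        | zero => simp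
        | succ j ihj =>
          intro hj
          have h1 := hd (show j ≤ b by omega)
          have h2 := ihj (by omega)
          simp only at h1
          linarith
      exact (key a hab).trans (le_max_left _ _)

/-- A single upward step would be followed by steps at least as large, hence by unbounded linear
growth. -/
theorem antitone_of_convex_of_bddAbove {m : ℕ → ℝ}
    (hm : ∀ k, 0 ≤ m (k + 2) - 2 * m (k + 1) + m k) {C : ℝ} (hC : ∀ k, m k ≤ C) :
    Antitone m := by
  have hd := monotone_diff_of_convex hm
  refine antitone_nat_of_succ_le fun j => ?_
  by_contra! hj
  have key : ∀ k : ℕ, m j + k * (m (j + 1) - m j) ≤ m (j + k) := by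
    intro k
    induction k with
    | zero => simp
    | succ k ih =>
      have h1 := hd (show j ≤ j + k by omega)
      simp only at h1
      rw [← add_assoc]
      push_cast
      linarith
  obtain ⟨k, hk⟩ := exists_nat_gt ((C - m j) / (m (j + 1) - m j))
  rw [div_lt_iff₀ (by linarith)] at hk
  linarith [key k, hC (j + k)]

end ConvexSequence

/-! ### Bounded orbits of a positive operator. -/

section PositiveOperator

open Filter Topology RCLike
open scoped InnerProductSpace

variable {𝕜 E : Type*} [RCLike 𝕜] [NormedAddCommGroup E] [InnerProductSpace 𝕜 E]

namespace ContinuousLinearMap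

variable {A : E →L[𝕜] E}

variable (A) in
/-- The vectors on which the powers of `A` are bounded. -/
def powBounded : Submodule 𝕜 E where
  carrier := {u | ∃ C : ℝ, ∀ n, ‖(A ^ n) u‖ ≤ C}
  zero_mem' := ⟨0, by simp⟩
  add_mem' := by
    rintro u v ⟨C, hC⟩ ⟨D, hD⟩
    refine ⟨C + D, fun n => ?_⟩
    rw [map_add]
    exact (norm_add_le _ _).trans (add_le_add (hC n) (hD n))
  smul_mem' := by
    rintro c u ⟨C, hC⟩
    refine ⟨‖c‖ * C, fun n => ?_⟩
    rw [map_smul, norm_smul]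
    exact mul_le_mul_of_nonneg_left (hC n) (norm_nonneg _)

theorem apply_mem_powBounded {B : E →L[𝕜] E} (hB : Commute A B) {u : E}
    (hu : u ∈ A.powBounded) : B u ∈ A.powBounded := by
  obtain ⟨C, hC⟩ := hu
  refine ⟨‖B‖ * C, fun n => ?_⟩
  have : (A ^ n) (B u) = B ((A ^ n) u) := congr($((hB.pow_left n).eq) u)
  rw [this]
  exact (B.le_opNorm _).trans (mul_le_mul_of_nonneg_left (hC n) (norm_nonneg _))

theorem IsPositive.re_inner_pow_nonneg (hA : A.IsPositive) (n : ℕ) (w : E) :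
    0 ≤ re ⟪(A ^ n) w, w⟫_𝕜 := by
  induction n using Nat.twoStepInduction generalizing w with
  | zero => simp
  | one => simpa using hA.re_inner_nonneg_left w
  | more n ih _ =>
    have h : (A ^ (n + 2)) w = A ((A ^ n) (A w)) := by
      rw [pow_succ', pow_succ]; rfl
    rw [h, hA.inner_left_eq_inner_right]
    exact ih (A w)

/-- The second difference equals `⟪A ^ k x, x⟫` with `x = A w - w`. -/
theorem IsPositive.re_inner_pow_convex (hA : A.IsPositive) (w : E) (k : ℕ) :
    0 ≤ re ⟪(A ^ (k + 2)) w, w⟫_𝕜 - 2 * re ⟪(A ^ (k + 1)) w, w⟫_𝕜 + re ⟪(A ^ k) w, w⟫_𝕜 := by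
  have h := hA.re_inner_pow_nonneg k (A w - w)
  have h1 : (A ^ (k + 1)) w = A ((A ^ k) w) := by rw [pow_succ']; rfl
  have h1' : (A ^ (k + 1)) w = (A ^ k) (A w) := by rw [pow_succ]; rfl
  have h2 : (A ^ (k + 2)) w = A ((A ^ k) (A w)) := by rw [pow_succ', pow_succ]; rfl
  rw [map_sub, inner_sub_left, inner_sub_right, inner_sub_right,
    ← hA.inner_left_eq_inner_right, ← hA.inner_left_eq_inner_right, ← h2, ← h1, ← h1'] at h
  simp only [map_sub] at h
  linarith

end ContinuousLinearMap

variable [CompleteSpace E]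

/-- A bounded sequence in a Hilbert space converges weakly along an ultrafilter. -/
theorem exists_weak_limit_of_bounded (F : Ultrafilter ℕ) (w : ℕ → E) (C : ℝ)
    (hw : ∀ n, ‖w n‖ ≤ C) :
    ∃ u : E, ∀ y, Tendsto (fun n => ⟪w n, y⟫_𝕜) F (𝓝 ⟪u, y⟫_𝕜) := by
  let x : ℕ → WeakDual 𝕜 E := fun n => StrongDual.toWeakDual (InnerProductSpace.toDual 𝕜 E (w n))
  have hc := WeakDual.isCompact_closedBall (𝕜 := 𝕜) (0 : StrongDual 𝕜 E) C
  obtain ⟨z, -, hz⟩ := hc.ultrafilter_le_nhds (F.map x) (by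
    rw [Ultrafilter.coe_map, le_principal_iff]
    refine Filter.mem_map.2 (univ_mem' fun n => ?_)
    simpa [x] using hw n)
  refine ⟨(InnerProductSpace.toDual 𝕜 E).symm (WeakDual.toStrongDual z), fun y => ?_⟩
  rw [InnerProductSpace.toDual_symm_apply]
  have h := ((WeakDual.eval_continuous y).tendsto z).mono_left hz
  rw [Ultrafilter.coe_map, tendsto_map'_iff] at h
  exact h

namespace ContinuousLinearMap.IsPositive

variable {A : E →L[𝕜] E}

theorem inner_pow_left (hA : A.IsPositive) (n : ℕ) (x y : E) :
    ⟪(A ^ n) x, y⟫_𝕜 = ⟪x, (A ^ n) y⟫_𝕜 :=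
  (hA.isSelfAdjoint.pow n).isSymmetric x y

theorem re_inner_pow_add (hA : A.IsPositive) (m n : ℕ) (w : E) :
    re ⟪(A ^ m) w, (A ^ n) w⟫_𝕜 = re ⟪(A ^ (m + n)) w, w⟫_𝕜 := by
  rw [← hA.inner_pow_left, add_comm, pow_add]; rfl

theorem norm_pow_sq (hA : A.IsPositive) (n : ℕ) (w : E) :
    ‖(A ^ n) w‖ ^ 2 = re ⟪(A ^ (n + n)) w, w⟫_𝕜 := by
  rw [← hA.re_inner_pow_add, inner_self_eq_norm_sq]

theorem norm_add_pow_sq (hA : A.IsPositive) (n : ℕ) (w : E) :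
    ‖w + (A ^ n) w‖ ^ 2 =
      re ⟪(A ^ 0) w, w⟫_𝕜 + 2 * re ⟪(A ^ n) w, w⟫_𝕜 + re ⟪(A ^ (n + n)) w, w⟫_𝕜 := by
  rw [@norm_add_sq 𝕜, hA.norm_pow_sq, ← hA.inner_pow_left, pow_zero,
    one_apply_eq_self, inner_self_eq_norm_sq]

/-- With `m k = ⟪A ^ k w, w⟫`, convexity bounds `m (2m)` by the larger of the end values `m 0` and
`m (2n)`, and both are terms of the expanded right-hand side. -/
theorem norm_pow_le_norm_add_pow (hA : A.IsPositive) {m n : ℕ} (hmn : m ≤ n) (w : E) :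
    ‖(A ^ m) w‖ ≤ ‖w + (A ^ n) w‖ := by
  refine (sq_le_sq₀ (norm_nonneg _) (norm_nonneg _)).1 ?_
  rw [hA.norm_pow_sq, hA.norm_add_pow_sq]
  have h := le_max_of_convex (m := fun k => re ⟪(A ^ k) w, w⟫_𝕜) (hA.re_inner_pow_convex w)
    (add_le_add hmn hmn)
  have h0 := hA.re_inner_pow_nonneg 0 w
  have h1 := hA.re_inner_pow_nonneg n w
  have h2 := hA.re_inner_pow_nonneg (n + n) w
  rcases le_max_iff.1 h with h | h <;> linarith

/-- This bound, uniform in `n`, keeps the weak limit of the solutions `w` away from zero. It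
compares the first difference of `⟪A ^ k w, w⟫` with the one at `2n`. -/
theorem norm_sq_sub_le_two_mul_re_inner (hA : A.IsPositive) (n : ℕ) {v w : E}
    (hv : v = w + (A ^ n) w) :
    ‖v‖ ^ 2 - re ⟪A v, v⟫_𝕜 ≤ 2 * re ⟪w, v⟫_𝕜 := by
  have hAv : A v = (A ^ 1) w + (A ^ (n + 1)) w := by
    rw [hv, map_add, pow_one, pow_succ']; rfl
  have e1 : re ⟪A v, v⟫_𝕜 = re ⟪(A ^ 1) w, w⟫_𝕜 + 2 * re ⟪(A ^ (n + 1)) w, w⟫_𝕜 +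
      re ⟪(A ^ (n + n + 1)) w, w⟫_𝕜 := by
    rw [hAv, hv, inner_add_left, inner_add_right, inner_add_right]
    simp only [map_add, hA.re_inner_pow_add]
    rw [add_comm 1 n, show n + 1 + n = n + n + 1 by ring]
    ring
  have e2 : re ⟪w, v⟫_𝕜 = re ⟪(A ^ 0) w, w⟫_𝕜 + re ⟪(A ^ n) w, w⟫_𝕜 := by
    rw [hv, inner_add_right, map_add, ← hA.inner_pow_left]; simp
  rw [e1, e2, hv, hA.norm_add_pow_sq]
  have h := monotone_diff_of_convex (m := fun k => re ⟪(A ^ k) w, w⟫_𝕜)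
    (hA.re_inner_pow_convex w) (Nat.zero_le (n + n))
  simp only [zero_add] at h
  have h0 := hA.re_inner_pow_nonneg 1 w
  have h1 := hA.re_inner_pow_nonneg (n + 1) w
  linarith

theorem exists_add_pow_eq (hA : A.IsPositive) (n : ℕ) (v : E) : ∃ w, w + (A ^ n) w = v := by
  have hu : IsUnit (1 + A ^ n) := by
    refine isUnit_of_forall_le_norm_inner_map _ (c := 1) one_pos fun x => ?_
    refine le_trans ?_ (re_le_norm _)
    have := hA.re_inner_pow_nonneg n x
    rw [add_apply, one_apply_eq_self, inner_add_left, map_add, inner_self_eq_norm_sq]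
    simpa using this
  obtain ⟨b, hb⟩ := hu.exists_right_inv
  exact ⟨b v, by simpa using congr($hb v)⟩

/-- A bounded convex sequence decreases, so any bound improves to `‖u‖`. This uniformity is what
makes `powBounded` closed. -/
theorem norm_le_of_forall_norm_pow_le (hA : A.IsPositive) {u : E} {C : ℝ}
    (hu : ∀ n, ‖(A ^ n) u‖ ≤ C) (n : ℕ) : ‖(A ^ n) u‖ ≤ ‖u‖ := by
  have hb : ∀ k, re ⟪(A ^ k) u, u⟫_𝕜 ≤ C * ‖u‖ := fun k =>
    ((re_le_norm _).trans (norm_inner_le_norm _ _)).trans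
      (mul_le_mul_of_nonneg_right (hu k) (norm_nonneg _))
  have h := antitone_of_convex_of_bddAbove (m := fun k => re ⟪(A ^ k) u, u⟫_𝕜)
    (hA.re_inner_pow_convex u) hb (Nat.zero_le (n + n))
  refine (sq_le_sq₀ (norm_nonneg _) (norm_nonneg _)).1 ?_
  rw [hA.norm_pow_sq]
  refine h.trans ?_
  simp

theorem mem_powBounded_iff (hA : A.IsPositive) {u : E} :
    u ∈ A.powBounded ↔ ∀ n, ‖(A ^ n) u‖ ≤ ‖u‖ :=
  ⟨fun ⟨_, hC⟩ => hA.norm_le_of_forall_norm_pow_le hC, fun h => ⟨_, h⟩⟩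

theorem isClosed_powBounded (hA : A.IsPositive) : IsClosed (A.powBounded : Set E) := by
  have : (A.powBounded : Set E) = ⋂ n : ℕ, {u | ‖(A ^ n) u‖ ≤ ‖u‖} := by
    ext u
    simp [hA.mem_powBounded_iff]
  rw [this]
  exact isClosed_iInter fun n =>
    isClosed_le ((A ^ n).continuous.norm) continuous_norm

/-- The vectors `w n = (1 + A ^ n)⁻¹ v` approximate a spectral cut-off of `v` to `[0, 1]`: as `n`
grows, `1 / (1 + t ^ n)` tends to 1 for `t < 1` and to 0 for `t > 1`. A weak limit of them has
bounded orbit and is nonzero. -/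
theorem powBounded_ne_bot (hA : A.IsPositive) {v : E} (hv : re ⟪A v, v⟫_𝕜 < ‖v‖ ^ 2) :
    A.powBounded ≠ ⊥ := by
  choose w hw using fun n => hA.exists_add_pow_eq n v
  have hbound : ∀ m n, m ≤ n → ‖(A ^ m) (w n)‖ ≤ ‖v‖ := fun m n hmn =>
    (hA.norm_pow_le_norm_add_pow hmn (w n)).trans_eq (by rw [hw n])
  obtain ⟨u, hu⟩ := exists_weak_limit_of_bounded (𝕜 := 𝕜) (hyperfilter ℕ) w ‖v‖
    fun n => by simpa using hbound 0 n (Nat.zero_le n)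
  have hmem : u ∈ A.powBounded := by
    refine ⟨‖v‖, fun m => ?_⟩
    have key : ∀ y, ‖⟪(A ^ m) u, y⟫_𝕜‖ ≤ ‖v‖ * ‖y‖ := fun y => by
      rw [hA.inner_pow_left]
      refine le_of_tendsto (hu ((A ^ m) y)).norm ?_
      -- The bound on `A ^ m` holds only for `n ≥ m`, which is eventual along the hyperfilter.
      refine Nat.hyperfilter_le_atTop ((eventually_ge_atTop m).mono fun n hn => ?_)
      rw [← hA.inner_pow_left]
      exact (norm_inner_le_norm _ _).trans
        (mul_le_mul_of_nonneg_right (hbound m n hn) (norm_nonneg _))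
    have h := key ((A ^ m) u)
    rw [inner_self_eq_norm_sq_to_K, norm_pow, norm_ofReal, abs_norm, sq] at h
    rcases (norm_nonneg ((A ^ m) u)).eq_or_lt with h0 | h0
    · rw [← h0]; exact norm_nonneg _
    · exact le_of_mul_le_mul_right h h0
  intro hbot
  rw [hbot, Submodule.mem_bot] at hmem
  have hlim : Tendsto (fun n => re ⟪w n, v⟫_𝕜) (hyperfilter ℕ) (𝓝 (re ⟪u, v⟫_𝕜)) :=
    (continuous_re.tendsto _).comp (hu v)
  have h := ge_of_tendsto hlim (b := (‖v‖ ^ 2 - re ⟪A v, v⟫_𝕜) / 2)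
    (Eventually.of_forall fun n => by
      linarith [hA.norm_sq_sub_le_two_mul_re_inner n (hw n).symm])
  rw [hmem, inner_zero_left, map_zero] at h
  linarith

end ContinuousLinearMap.IsPositive

end PositiveOperator

/-! ### Subspaces on which operators are bounded below. -/

section BoundedBelow

open Filter Topology RCLike ContinuousLinearMap
open scoped InnerProductSpace

variable {𝕜 E : Type*} [RCLike 𝕜] [NormedAddCommGroup E] [InnerProductSpace 𝕜 E] [CompleteSpace E]

/-- For a nonzero self-adjoint operator `R` there is a nonzero closed subspace, invariant under
the commutant of `R`, on which `R ^ 2` is bounded below. -/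
theorem IsSelfAdjoint.exists_submodule_norm_le {R : E →L[𝕜] E} (hR : IsSelfAdjoint R)
    (hR0 : R ≠ 0) :
    ∃ K : Submodule 𝕜 E, IsClosed (K : Set E) ∧ K ≠ ⊥ ∧
      (∀ B : E →L[𝕜] E, Commute R B → ∀ u ∈ K, B u ∈ K) ∧
      ∀ u ∈ K, ‖R‖ ^ 2 / 2 * ‖u‖ ≤ ‖R (R u)‖ := by
  have hr : 0 < ‖R‖ := norm_pos_iff.2 hR0
  have hr2 : 0 < ‖R‖ ^ 2 := by positivity
  -- The largest `c` for which `2 - c R²` is guaranteed positive; `A ≤ 1` then corresponds to `R² ≥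
  -- ‖R‖² / 2`.
  set c : ℝ := 2 / ‖R‖ ^ 2 with hc
  have hc0 : 0 < c := by positivity
  let A : E →L[𝕜] E := (2 : 𝕜) • 1 - (c : 𝕜) • (R * R)
  have hA_apply : ∀ u, A u = (2 : 𝕜) • u - (c : 𝕜) • R (R u) := fun u => rfl
  have hA_inner : ∀ u, re ⟪A u, u⟫_𝕜 = 2 * ‖u‖ ^ 2 - c * ‖R u‖ ^ 2 := fun u => by
    have h : ⟪R (R u), u⟫_𝕜 = ⟪R u, R u⟫_𝕜 := hR.isSymmetric (R u) u
    rw [hA_apply, inner_sub_left, inner_smul_left, inner_smul_left, h, map_sub, conj_ofReal,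
      re_ofReal_mul, inner_self_eq_norm_sq, map_ofNat, ← ofReal_ofNat, re_ofReal_mul,
      inner_self_eq_norm_sq]
  have hA : A.IsPositive := by
    refine isPositive_def'.2 ⟨?_, fun u => ?_⟩
    · refine IsSelfAdjoint.sub ?_ ?_
      · exact IsSelfAdjoint.smul (by simp) (IsSelfAdjoint.one _)
      · refine IsSelfAdjoint.smul (conj_ofReal c) ?_
        rw [← sq]; exact hR.pow 2
    · rw [reApplyInnerSelf_apply, hA_inner]
      have h := pow_le_pow_left₀ (norm_nonneg _) (R.le_opNorm u) 2
      have : c * ‖R u‖ ^ 2 ≤ c * (‖R‖ * ‖u‖) ^ 2 := mul_le_mul_of_nonneg_left h hc0.le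
      have e : c * (‖R‖ * ‖u‖) ^ 2 = 2 * ‖u‖ ^ 2 := by rw [hc]; field_simp
      linarith
  refine ⟨A.powBounded, hA.isClosed_powBounded, ?_, fun B hB u hu => ?_, fun u hu => ?_⟩
  -- A vector nearly attaining `‖R‖`, enough for `c ‖R v‖² > ‖v‖²`.
  · obtain ⟨v, hv⟩ : ∃ v, Real.sqrt (1 / 2) * ‖R‖ * ‖v‖ < ‖R v‖ := by
      by_contra! h
      have h1 := R.opNorm_le_bound (by positivity) h
      have h2 : Real.sqrt (1 / 2) < 1 := by
        rw [Real.sqrt_lt' one_pos]; norm_num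
      nlinarith
    refine hA.powBounded_ne_bot (v := v) ?_
    rw [hA_inner]
    have h := pow_lt_pow_left₀ hv (by positivity) two_ne_zero
    rw [mul_pow, mul_pow, Real.sq_sqrt (by norm_num)] at h
    have h3 := mul_lt_mul_of_pos_left h hc0
    have e : c * (1 / 2 * ‖R‖ ^ 2 * ‖v‖ ^ 2) = ‖v‖ ^ 2 := by rw [hc]; field_simp
    linarith
  · refine apply_mem_powBounded ?_ hu
    exact ((Commute.one_left B).smul_left _).sub_left ((hB.mul_left hB).smul_left _)
  · have h1 : ‖A u‖ ≤ ‖u‖ := by simpa using hA.mem_powBounded_iff.1 hu 1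
    have h2 : (2 : 𝕜) • u = A u + (c : 𝕜) • R (R u) := by rw [hA_apply]; abel
    have h3 : 2 * ‖u‖ ≤ ‖A u‖ + c * ‖R (R u)‖ := by
      calc 2 * ‖u‖ = ‖(2 : 𝕜) • u‖ := by rw [norm_smul, RCLike.norm_ofNat]
        _ ≤ ‖A u‖ + ‖(c : 𝕜) • R (R u)‖ := h2 ▸ norm_add_le _ _
        _ = _ := by rw [norm_smul, norm_ofReal, abs_of_pos hc0]
    have h4 : ‖u‖ ≤ c * ‖R (R u)‖ := by linarith
    have h5 := mul_le_mul_of_nonneg_left h4 (by positivity : 0 ≤ ‖R‖ ^ 2 / 2)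
    have e : ‖R‖ ^ 2 / 2 * (c * ‖R (R u)‖) = ‖R (R u)‖ := by rw [hc]; field_simp
    linarith

variable {F₁ F₂ : Type*} [NormedAddCommGroup F₁] [InnerProductSpace 𝕜 F₁] [CompleteSpace F₁]
  [NormedAddCommGroup F₂] [InnerProductSpace 𝕜 F₂] [CompleteSpace F₂]

/-- If two injective operators `p₁`, `p₂` satisfy `p₁† p₁ + p₂† p₂ = 1`, then they are both bounded
below on some nonzero closed subspace invariant under the commutant of `p₁† p₁`. -/
theorem exists_submodule_bounded_below [Nontrivial E] (p₁ : E →L[𝕜] F₁) (p₂ : E →L[𝕜] F₂)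
    (hp : ∀ u v, ⟪u, v⟫_𝕜 = ⟪p₁ u, p₁ v⟫_𝕜 + ⟪p₂ u, p₂ v⟫_𝕜)
    (h₁ : ∀ u, p₁ u = 0 → u = 0) (h₂ : ∀ u, p₂ u = 0 → u = 0) :
    ∃ K : Submodule 𝕜 E, IsClosed (K : Set E) ∧ K ≠ ⊥ ∧
      (∀ B : E →L[𝕜] E, Commute (adjoint p₁ ∘L p₁) B → ∀ u ∈ K, B u ∈ K) ∧
      ∃ ε : ℝ, 0 < ε ∧ ∀ u ∈ K, ε * ‖u‖ ≤ ‖p₁ u‖ ∧ ε * ‖u‖ ≤ ‖p₂ u‖ := by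
  set S₁ : E →L[𝕜] E := adjoint p₁ ∘L p₁ with hS₁
  set S₂ : E →L[𝕜] E := adjoint p₂ ∘L p₂ with hS₂
  have hsum : S₂ = 1 - S₁ := by
    ext u
    refine ext_inner_right 𝕜 fun v => ?_
    simp [hS₁, hS₂, inner_sub_left, adjoint_inner_left, hp u v]
  have hcomm : Commute S₁ S₂ := by
    rw [hsum]; exact (Commute.one_right _).sub_right (Commute.refl _)
  have hself₁ : IsSelfAdjoint S₁ := (isPositive_adjoint_comp_self p₁).isSelfAdjoint
  have hself₂ : IsSelfAdjoint S₂ := (isPositive_adjoint_comp_self p₂).isSelfAdjoint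
  -- Each `Sᵢ` is injective because `pᵢ` is.
  have hR0 : S₁ * S₂ ≠ 0 := by
    intro h0
    obtain ⟨u, hu⟩ := exists_ne (0 : E)
    have h3 : S₁ (S₂ u) = 0 := congr($h0 u)
    refine hu (h₂ u ?_)
    rw [← inner_self_eq_zero (𝕜 := 𝕜), ← adjoint_inner_left]
    have h4 : adjoint p₂ (p₂ u) = 0 := h₁ _ (by
      rw [← inner_self_eq_zero (𝕜 := 𝕜), ← adjoint_inner_left]
      have h' : adjoint p₁ (p₁ (adjoint p₂ (p₂ u))) = 0 := h3
      rw [h', inner_zero_left])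
    rw [h4, inner_zero_left]
  obtain ⟨K, hKc, hK0, hKinv, hK⟩ :=
    ((hself₁.commute_iff hself₂).1 hcomm).exists_submodule_norm_le hR0
  refine ⟨K, hKc, hK0, fun B hB => hKinv B ?_, ?_⟩
  · refine hB.mul_left ?_
    rw [hsum]; exact (Commute.one_left _).sub_left hB
  set r := ‖S₁ * S₂‖ ^ 2 / 2 with hr
  have hr0 : 0 < r := by have := norm_pos_iff.2 hR0; positivity
  -- Since `S₁` and `S₂` commute, `(S₁ S₂)²` factors through `p₁` and also through `p₂`, so its
  -- lower bound on `K` passes to both.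
  set T₁ : F₁ →L[𝕜] E := (S₁ * S₂ * S₂) ∘L adjoint p₁
  set T₂ : F₂ →L[𝕜] E := (S₁ * S₂ * S₁) ∘L adjoint p₂
  have e₁ : ∀ u, (S₁ * S₂) ((S₁ * S₂) u) = T₁ (p₁ u) := fun u => by
    have : (S₁ * S₂) * (S₁ * S₂) = S₁ * S₂ * S₂ * S₁ := by
      rw [mul_assoc _ S₂ S₁, ← hcomm.eq]
    exact congr($this u)
  have e₂ : ∀ u, (S₁ * S₂) ((S₁ * S₂) u) = T₂ (p₂ u) := fun u => rfl
  have hpos : 0 < ‖T₁‖ + ‖T₂‖ + 1 := by positivity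
  refine ⟨r / (‖T₁‖ + ‖T₂‖ + 1), by positivity, fun u hu => ?_⟩
  have h := hK u hu
  constructor
  · rw [div_mul_eq_mul_div, div_le_iff₀ hpos]
    rw [e₁] at h
    nlinarith [T₁.le_opNorm (p₁ u), norm_nonneg T₂, norm_nonneg (p₁ u)]
  · rw [div_mul_eq_mul_div, div_le_iff₀ hpos]
    rw [e₂] at h
    nlinarith [T₂.le_opNorm (p₂ u), norm_nonneg T₁, norm_nonneg (p₂ u)]

end BoundedBelow

/-! ### Invariant affine subspaces and projected actions. -/

namespace AffineIsometricAction

open ContinuousLinearMap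
open scoped InnerProductSpace

section General

variable {𝕜 G H : Type*} [RCLike 𝕜] [Group G] [NormedAddCommGroup H] [InnerProductSpace 𝕜 H]

/-- An invariant affine subspace of an irreducible action is dense. -/
theorem IsIrreducible.dense {α : AffineIsometricAction 𝕜 G H} (hα : IsIrreducible α)
    {S : AffineSubspace 𝕜 H} (hne : (S : Set H).Nonempty) (hS : ∀ g : G, ∀ v ∈ S, α g v ∈ S) :
    Dense (S : Set H) := by
  let T : AffineSubspace 𝕜 H :=
    { carrier := closure (S : Set H)
      smul_vsub_vadd_mem' := fun c p₁ p₂ p₃ h₁ h₂ h₃ => by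
        -- The ternary affine operation is passed to the closure two arguments at a time.
        have h := map_mem_closure₂ (f := fun x y : H => c • (x - y)) (by fun_prop) h₁ h₂
          (u := {z | ∀ y ∈ S, z + y ∈ S})
          fun a ha b hb y hy => S.smul_vsub_vadd_mem c ha hb hy
        exact map_mem_closure₂ continuous_add h h₃ fun a ha b hb => ha b hb }
  have hT := hα T hne.closure isClosed_closure fun g v hv =>
    map_mem_closure (α g).continuous hv fun w hw => hS g w hw
  rw [dense_iff_closure_eq]
  exact congrArg (fun W : AffineSubspace 𝕜 H => (W : Set H)) hT

theorem linearPart_sub (α : AffineIsometricAction 𝕜 G H) (g : G) (v w : H) :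
    linearPart α g (v - w) = α g v - α g w := by
  rw [apply_eq α g v, apply_eq α g w, map_sub]; abel

theorem inner_linearPart_left (α : AffineIsometricAction 𝕜 G H) (g : G) (v w : H) :
    ⟪linearPart α g v, w⟫_𝕜 = ⟪v, linearPart α g⁻¹ w⟫_𝕜 := by
  rw [← (linearPart α g).inner_map_map v, map_inv]
  simp

/-- The orthogonal complement of the direction of an invariant affine subspace. -/
def orthogonalDirection (α : AffineIsometricAction 𝕜 G H) (W : AffineSubspace 𝕜 H)
    (hne : (W : Set H).Nonempty) (hW : ∀ g : G, ∀ v ∈ W, α g v ∈ W) : Subrep α where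
  carrier := W.directionᗮ
  isClosed := W.direction.isClosed_orthogonal
  invariant g v hv := by
    rw [Submodule.mem_orthogonal'] at hv ⊢
    intro d hd
    rw [inner_linearPart_left]
    refine hv _ ?_
    obtain ⟨x, hx, y, hy, rfl⟩ := (AffineSubspace.mem_direction_iff_eq_vsub hne d).1 hd
    rw [vsub_eq_sub, linearPart_sub]
    exact AffineSubspace.vsub_mem_direction (hW _ _ hx) (hW _ _ hy)

variable [CompleteSpace H]

theorem Subrep.projectedAction_orthogonalProjection {α : AffineIsometricAction 𝕜 G H}
    (V : Subrep α) (g : G) (x : H) :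
    V.projectedAction g (V.carrier.orthogonalProjectionOnto x) =
      V.carrier.orthogonalProjectionOnto (α g x) := by
  rw [Subrep.projectedAction, ofCocycle_apply, ← Subrep.orthogonalProjection_linearPart,
    apply_eq α g x, map_add]

end General

section Prod

variable {𝕜 G H₁ H₂ : Type*} [RCLike 𝕜] [Group G]
  [NormedAddCommGroup H₁] [InnerProductSpace 𝕜 H₁] [NormedAddCommGroup H₂] [InnerProductSpace 𝕜 H₂]
  {α₁ : AffineIsometricAction 𝕜 G H₁} {α₂ : AffineIsometricAction 𝕜 G H₂}

theorem linearPart_directSum (g : G) (x : WithLp 2 (H₁ × H₂)) :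
    linearPart (directSum α₁ α₂) g x =
      WithLp.toLp 2 (linearPart α₁ g x.fst, linearPart α₂ g x.snd) := by
  have h := linearPart_sub (directSum α₁ α₂) g x 0
  rw [sub_zero, directSum_apply, directSum_apply] at h
  have h₁ := linearPart_sub α₁ g x.fst 0
  have h₂ := linearPart_sub α₂ g x.snd 0
  rw [sub_zero] at h₁ h₂
  rw [h, h₁, h₂]
  rfl

/-- The graph of an equivalence of projected actions gives an invariant affine subspace. -/
theorem isReducible_directSum_of_equivalent [CompleteSpace H₁] [CompleteSpace H₂]
    (V₁ : Subrep α₁) (V₂ : Subrep α₂) (hV₂ : V₂.carrier ≠ ⊥)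
    (h : Equivalent V₁.projectedAction V₂.projectedAction) :
    IsReducible (directSum α₁ α₂) := by
  obtain ⟨A, hA⟩ := h
  let f : WithLp 2 (H₁ × H₂) →ᵃ[𝕜] V₂.carrier :=
    A.toAffineEquiv.toAffineMap.comp
      (V₁.carrier.orthogonalProjectionOnto ∘L WithLp.fstL 2 𝕜 H₁ H₂).toLinearMap.toAffineMap -
    (V₂.carrier.orthogonalProjectionOnto ∘L WithLp.sndL 2 𝕜 H₁ H₂).toLinearMap.toAffineMap
  have hf : ∀ x, f x = A (V₁.carrier.orthogonalProjectionOnto x.fst) -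
      V₂.carrier.orthogonalProjectionOnto x.snd := fun x => rfl
  let W : AffineSubspace 𝕜 (WithLp 2 (H₁ × H₂)) := (AffineSubspace.mk' 0 ⊥).comap f
  have hW : ∀ x, x ∈ W ↔ A (V₁.carrier.orthogonalProjectionOnto x.fst) =
      V₂.carrier.orthogonalProjectionOnto x.snd := fun x => by
    simp [W, AffineSubspace.mem_comap, AffineSubspace.mem_mk', hf, sub_eq_zero]
  have hproj : ∀ v : V₂.carrier, V₂.carrier.orthogonalProjectionOnto (v : H₂) = v := fun v =>
    V₂.carrier.orthogonalProjectionOnto_mem_subspace_eq_self v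
  refine ⟨W, ⟨WithLp.toLp 2 (0, (A 0 : V₂.carrier)), ?_⟩, ?_, ?_, fun g v hv => ?_⟩
  · rw [SetLike.mem_coe, hW]
    simp [hproj]
  · have : (W : Set (WithLp 2 (H₁ × H₂))) =
        {x | A (V₁.carrier.orthogonalProjectionOnto (WithLp.fstL 2 𝕜 H₁ H₂ x)) =
          V₂.carrier.orthogonalProjectionOnto (WithLp.sndL 2 𝕜 H₁ H₂ x)} := by
      ext x; exact hW x
    rw [this]
    exact isClosed_eq (A.continuous.comp (by fun_prop)) (by fun_prop)
  -- Otherwise `(0, 0)` and `(0, v)` would both satisfy the equation, forcing `v = 0`.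
  · intro htop
    obtain ⟨v, hv, hv0⟩ := Submodule.exists_mem_ne_zero_of_ne_bot hV₂
    have h1 := (hW (WithLp.toLp 2 (0, 0))).1 (htop ▸ AffineSubspace.mem_top 𝕜 _ _)
    have h2 := (hW (WithLp.toLp 2 (0, v))).1 (htop ▸ AffineSubspace.mem_top 𝕜 _ _)
    have h3 := hproj ⟨v, hv⟩
    simp only [WithLp.toLp_fst, WithLp.toLp_snd, map_zero] at h1 h2 h3
    rw [h1, h3] at h2
    exact hv0 congr(($h2 : H₂)).symm
  · rw [hW] at hv ⊢
    rw [directSum_apply]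
    change A (V₁.carrier.orthogonalProjectionOnto (α₁ g v.fst)) =
      V₂.carrier.orthogonalProjectionOnto (α₂ g v.snd)
    rw [← Subrep.projectedAction_orthogonalProjection,
      ← Subrep.projectedAction_orthogonalProjection, hA, hv]

/-- The adjoint of an isomorphism of Hilbert spaces. -/
noncomputable def _root_.ContinuousLinearEquiv.hilbertAdjoint {K V : Type*}
    [NormedAddCommGroup K] [InnerProductSpace 𝕜 K] [CompleteSpace K]
    [NormedAddCommGroup V] [InnerProductSpace 𝕜 V] [CompleteSpace V] (e : K ≃L[𝕜] V) : V ≃L[𝕜] K :=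
  ContinuousLinearEquiv.equivOfInverse (adjoint (e : K →L[𝕜] V)) (adjoint (e.symm : V →L[𝕜] K))
    (fun v => ext_inner_right 𝕜 fun w => by simp [adjoint_inner_left])
    (fun v => ext_inner_right 𝕜 fun w => by simp [adjoint_inner_left])

theorem _root_.ContinuousLinearEquiv.hilbertAdjoint_inner_left {K V : Type*}
    [NormedAddCommGroup K] [InnerProductSpace 𝕜 K] [CompleteSpace K]
    [NormedAddCommGroup V] [InnerProductSpace 𝕜 V] [CompleteSpace V] (e : K ≃L[𝕜] V) (v : V)
    (k : K) : ⟪e.hilbertAdjoint v, k⟫_𝕜 = ⟪v, e k⟫_𝕜 :=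
  adjoint_inner_left (e : K →L[𝕜] V) k v

theorem _root_.Submodule.inner_orthogonalProjectionOnto_left {H : Type*} [NormedAddCommGroup H]
    [InnerProductSpace 𝕜 H] (V : Submodule 𝕜 H) [V.HasOrthogonalProjection] (x : H) (v : V) :
    ⟪V.orthogonalProjectionOnto x, v⟫_𝕜 = ⟪x, (v : H)⟫_𝕜 := by
  have h := V.starProjection_inner_eq_zero x v v.2
  rw [inner_sub_left, sub_eq_zero] at h
  exact h.symm

/-- If an invariant affine subspace `W` with dense first projection is contained in the level set of
the functionals `⟪(e₁ k, e₂ k), ·⟫`, then the projected actions on the ranges of `e₁` and `e₂` are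
equivalent. -/
theorem equivalent_projectedAction [CompleteSpace H₁] [CompleteSpace H₂] {K : Type*}
    [NormedAddCommGroup K] [InnerProductSpace 𝕜 K] [CompleteSpace K]
    {V₁ : Subrep α₁} {V₂ : Subrep α₂} (e₁ : K ≃L[𝕜] V₁.carrier) (e₂ : K ≃L[𝕜] V₂.carrier)
    {W : Set (WithLp 2 (H₁ × H₂))} (hW : ∀ g : G, ∀ v ∈ W, directSum α₁ α₂ g v ∈ W)
    (hd : Dense (WithLp.fst '' W)) {w₀ : WithLp 2 (H₁ × H₂)}
    (hw₀ : ∀ w ∈ W, ∀ k, ⟪w.fst, (e₁ k : H₁)⟫_𝕜 + ⟪w.snd, (e₂ k : H₂)⟫_𝕜 =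
      ⟪w₀.fst, (e₁ k : H₁)⟫_𝕜 + ⟪w₀.snd, (e₂ k : H₂)⟫_𝕜) :
    Equivalent V₁.projectedAction V₂.projectedAction := by
  let P₁ := V₁.carrier.orthogonalProjectionOnto
  let P₂ := V₂.carrier.orthogonalProjectionOnto
  -- The level-set equations say `e₁† (P₁ w.fst) + e₂† (P₂ w.snd) = k₀` on `W`; solving for `P₂
  -- w.snd` gives `A`.
  let k₀ : K := e₁.hilbertAdjoint (P₁ w₀.fst) + e₂.hilbertAdjoint (P₂ w₀.snd)
  let A : V₁.carrier ≃ᴬ[𝕜] V₂.carrier :=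
    (e₁.hilbertAdjoint.toContinuousAffineEquiv.trans (ContinuousAffineEquiv.constVSub 𝕜 k₀)).trans
      e₂.hilbertAdjoint.symm.toContinuousAffineEquiv
  have hA : ∀ v, A v = e₂.hilbertAdjoint.symm (k₀ - e₁.hilbertAdjoint v) := fun v => rfl
  have hAW : ∀ w ∈ W, A (P₁ w.fst) = P₂ w.snd := fun w hw => by
    rw [hA, ContinuousLinearEquiv.symm_apply_eq, sub_eq_iff_eq_add]
    refine ext_inner_right 𝕜 fun k => ?_
    simp only [k₀, P₁, P₂, inner_add_left, ContinuousLinearEquiv.hilbertAdjoint_inner_left,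
      Submodule.inner_orthogonalProjectionOnto_left]
    rw [← hw₀ w hw k, add_comm]
  refine ⟨A, fun g v => ?_⟩
  have hdense : Dense (P₁ '' (WithLp.fst '' W)) := by
    refine Function.Surjective.denseRange (f := P₁) ?_ |>.dense_image P₁.continuous hd
    exact fun v => ⟨v, V₁.carrier.orthogonalProjectionOnto_mem_subspace_eq_self v⟩
  refine congrFun (Continuous.ext_on hdense (f := fun v => A (V₁.projectedAction g v))
    (g := fun v => V₂.projectedAction g (A v)) (A.continuous.comp (AffineIsometryEquiv.continuous _))
    ((AffineIsometryEquiv.continuous _).comp A.continuous) ?_) v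
  rintro _ ⟨_, ⟨w, hw, rfl⟩, rfl⟩
  have h := hAW _ (hW g w hw)
  rw [directSum_apply] at h
  simp only [P₁, P₂] at h hAW ⊢
  rw [hAW w hw, Subrep.projectedAction_orthogonalProjection,
    Subrep.projectedAction_orthogonalProjection]
  exact h

end Prod

/-! ### From a reducible sum to equivalent projected actions. -/

section Main

variable {𝕜 G H₁ H₂ : Type*} [RCLike 𝕜] [Group G]
  [NormedAddCommGroup H₁] [InnerProductSpace 𝕜 H₁] [NormedAddCommGroup H₂] [InnerProductSpace 𝕜 H₂]
  {α₁ : AffineIsometricAction 𝕜 G H₁} {α₂ : AffineIsometricAction 𝕜 G H₂}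

theorem dense_fst_image (h₁ : IsIrreducible α₁) {W : AffineSubspace 𝕜 (WithLp 2 (H₁ × H₂))}
    (hne : (W : Set (WithLp 2 (H₁ × H₂))).Nonempty)
    (hW : ∀ g : G, ∀ v ∈ W, directSum α₁ α₂ g v ∈ W) :
    Dense (WithLp.fst '' (W : Set (WithLp 2 (H₁ × H₂)))) := by
  refine h₁.dense (S := W.map (WithLp.fstL 2 𝕜 H₁ H₂).toLinearMap.toAffineMap) (hne.image _) ?_
  rintro g _ ⟨w, hw, rfl⟩
  refine ⟨_, hW g w hw, ?_⟩
  rw [directSum_apply]; rfl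

theorem dense_snd_image (h₂ : IsIrreducible α₂) {W : AffineSubspace 𝕜 (WithLp 2 (H₁ × H₂))}
    (hne : (W : Set (WithLp 2 (H₁ × H₂))).Nonempty)
    (hW : ∀ g : G, ∀ v ∈ W, directSum α₁ α₂ g v ∈ W) :
    Dense (WithLp.snd '' (W : Set (WithLp 2 (H₁ × H₂)))) := by
  refine h₂.dense (S := W.map (WithLp.sndL 2 𝕜 H₁ H₂).toLinearMap.toAffineMap) (hne.image _) ?_
  rintro g _ ⟨w, hw, rfl⟩
  refine ⟨_, hW g w hw, ?_⟩
  rw [directSum_apply]; rfl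

/-- A vector whose inner products with the points of a dense set are constant vanishes. -/
theorem eq_zero_of_dense_of_inner_const {H : Type*} [NormedAddCommGroup H] [InnerProductSpace 𝕜 H]
    {S : Set H} (hS : Dense S) {u : H} {c : 𝕜} (h : ∀ x ∈ S, ⟪x, u⟫_𝕜 = c) : u = 0 := by
  have hc : ∀ x, ⟪x, u⟫_𝕜 = c := congrFun (Continuous.ext_on hS (f := fun x => ⟪x, u⟫_𝕜)
    (g := fun _ => c) (by fun_prop) (by fun_prop) h)
  have h0 := hc 0
  rw [inner_zero_left] at h0
  rw [← inner_self_eq_zero (𝕜 := 𝕜), hc u, ← h0]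

/-- The range of an operator, if it is closed and invariant under the linear part. -/
def rangeSubrep {H U : Type*} [NormedAddCommGroup H] [InnerProductSpace 𝕜 H]
    [NormedAddCommGroup U] [InnerProductSpace 𝕜 U]
    (α : AffineIsometricAction 𝕜 G H) (j : U →L[𝕜] H)
    (hj : IsClosed (Set.range j)) (hinv : ∀ (g : G) (u : U), ∃ u', j u' = linearPart α g (j u)) :
    Subrep α where
  carrier := j.range
  isClosed := hj
  invariant := by
    rintro g _ ⟨u, rfl⟩
    exact hinv g u

theorem exists_equivalent_of_isReducible_directSum [CompleteSpace H₁] [CompleteSpace H₂]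
    (h₁ : IsIrreducible α₁) (h₂ : IsIrreducible α₂) (h : IsReducible (directSum α₁ α₂)) :
    ∃ (V₁ : Subrep α₁) (V₂ : Subrep α₂), V₁.carrier ≠ ⊥ ∧ V₂.carrier ≠ ⊥ ∧
      Equivalent V₁.projectedAction V₂.projectedAction := by
  obtain ⟨W, hne, hcl, htop, hW⟩ := h
  obtain ⟨w₀, hw₀⟩ := id hne
  let U := orthogonalDirection (directSum α₁ α₂) W hne hW
  have hUconst : ∀ (u : U.carrier), ∀ w ∈ W,
      ⟪w.fst, (u : WithLp 2 (H₁ × H₂)).fst⟫_𝕜 + ⟪w.snd, (u : WithLp 2 (H₁ × H₂)).snd⟫_𝕜 =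
      ⟪w₀.fst, (u : WithLp 2 (H₁ × H₂)).fst⟫_𝕜 + ⟪w₀.snd, (u : WithLp 2 (H₁ × H₂)).snd⟫_𝕜 := by
    intro u w hw
    have := (Submodule.mem_orthogonal _ _).1 u.2 _ (AffineSubspace.vsub_mem_direction hw hw₀)
    rw [vsub_eq_sub, inner_sub_left, sub_eq_zero] at this
    exact this
  have : Nontrivial U.carrier := by
    rw [Submodule.nontrivial_iff_ne_bot]
    intro hbot
    have hclD : IsClosed (W.direction : Set (WithLp 2 (H₁ × H₂))) :=
      (AffineSubspace.isClosed_direction_iff W).2 hcl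
    have : CompleteSpace W.direction := hclD.completeSpace_coe
    have hD : W.direction = ⊤ := (Submodule.orthogonal_eq_bot_iff).1 hbot
    exact htop ((AffineSubspace.direction_eq_top_iff_of_nonempty hne).1 hD)
  let p₁ : U.carrier →L[𝕜] H₁ := WithLp.fstL 2 𝕜 H₁ H₂ ∘L U.carrier.subtypeL
  let p₂ : U.carrier →L[𝕜] H₂ := WithLp.sndL 2 𝕜 H₁ H₂ ∘L U.carrier.subtypeL
  have hp₁ : ∀ u : U.carrier, p₁ u = (u : WithLp 2 (H₁ × H₂)).fst := fun _ => rfl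
  have hp₂ : ∀ u : U.carrier, p₂ u = (u : WithLp 2 (H₁ × H₂)).snd := fun _ => rfl
  have hrep₁ : ∀ g u, p₁ (U.rep g u) = linearPart α₁ g (p₁ u) := fun g u => by
    rw [hp₁, Subrep.coe_rep_apply, linearPart_directSum]; rfl
  have hrep₂ : ∀ g u, p₂ (U.rep g u) = linearPart α₂ g (p₂ u) := fun g u => by
    rw [hp₂, Subrep.coe_rep_apply, linearPart_directSum]; rfl
  -- If the first coordinate of `u` vanishes, `⟪·, p₂ u⟫` is constant on the dense second projection
  -- of `W`.
  have hz₁ : ∀ u, p₁ u = 0 → u = 0 := fun u hu => by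
    have hu' : p₂ u = 0 := by
      refine eq_zero_of_dense_of_inner_const (dense_snd_image h₂ hne hW) (c := ⟪w₀.snd, p₂ u⟫_𝕜) ?_
      rintro _ ⟨w, hw, rfl⟩
      have := hUconst u w hw
      rw [← hp₁, ← hp₂, hu] at this
      simpa using this
    exact Subtype.ext (WithLp.ofLp_injective 2 (Prod.ext hu hu'))
  have hz₂ : ∀ u, p₂ u = 0 → u = 0 := fun u hu => by
    have hu' : p₁ u = 0 := by
      refine eq_zero_of_dense_of_inner_const (dense_fst_image h₁ hne hW) (c := ⟪w₀.fst, p₁ u⟫_𝕜) ?_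
      rintro _ ⟨w, hw, rfl⟩
      have := hUconst u w hw
      rw [← hp₁, ← hp₂, hu] at this
      simpa using this
    exact Subtype.ext (WithLp.ofLp_injective 2 (Prod.ext hu' hu))
  obtain ⟨K, hKc, hK0, hKinv, ε, hε, hK⟩ :=
    exists_submodule_bounded_below p₁ p₂ (fun u v => WithLp.prod_inner_apply _ _) hz₁ hz₂
  have : CompleteSpace K := hKc.completeSpace_coe
  -- `p₁` intertwines isometric representations, so `p₁† p₁` commutes with `U.rep g`.
  have hKrep : ∀ g, ∀ u ∈ K, U.rep g u ∈ K := fun g => by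
    refine hKinv ((U.rep g).toContinuousLinearEquiv : U.carrier →L[𝕜] U.carrier) ?_
    ext1 u
    refine ext_inner_right 𝕜 fun v => ?_
    change ⟪adjoint p₁ (p₁ (U.rep g u)), v⟫_𝕜 = ⟪U.rep g (adjoint p₁ (p₁ u)), v⟫_𝕜
    have hinv : ⟪U.rep g (adjoint p₁ (p₁ u)), v⟫_𝕜 = ⟪adjoint p₁ (p₁ u), U.rep g⁻¹ v⟫_𝕜 :=
      inner_linearPart_left (directSum α₁ α₂) g _ _
    rw [hinv, adjoint_inner_left, adjoint_inner_left, hrep₁, hrep₁, inner_linearPart_left]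
  let j₁ : K →L[𝕜] H₁ := p₁ ∘L K.subtypeL
  let j₂ : K →L[𝕜] H₂ := p₂ ∘L K.subtypeL
  have ha₁ : AntilipschitzWith ε⁻¹.toNNReal j₁ := j₁.antilipschitz_of_bound fun u => by
    rw [Real.coe_toNNReal _ (by positivity), ← div_eq_inv_mul, le_div_iff₀' hε]
    exact (hK u u.2).1
  have ha₂ : AntilipschitzWith ε⁻¹.toNNReal j₂ := j₂.antilipschitz_of_bound fun u => by
    rw [Real.coe_toNNReal _ (by positivity), ← div_eq_inv_mul, le_div_iff₀' hε]
    exact (hK u u.2).2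
  have hc₁ := ha₁.isClosed_range j₁.uniformContinuous
  have hc₂ := ha₂.isClosed_range j₂.uniformContinuous
  let V₁ : Subrep α₁ := rangeSubrep α₁ j₁ hc₁ fun g u => ⟨⟨_, hKrep g u u.2⟩, hrep₁ g u⟩
  let V₂ : Subrep α₂ := rangeSubrep α₂ j₂ hc₂ fun g u => ⟨⟨_, hKrep g u u.2⟩, hrep₂ g u⟩
  let e₁ : K ≃L[𝕜] V₁.carrier := j₁.equivRange ha₁.injective hc₁
  let e₂ : K ≃L[𝕜] V₂.carrier := j₂.equivRange ha₂.injective hc₂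
  have hKnt : Nontrivial K := Submodule.nontrivial_iff_ne_bot.2 hK0
  refine ⟨V₁, V₂, Submodule.nontrivial_iff_ne_bot.1 e₁.symm.surjective.nontrivial,
    Submodule.nontrivial_iff_ne_bot.1 e₂.symm.surjective.nontrivial,
    equivalent_projectedAction e₁ e₂ hW (dense_fst_image h₁ hne hW) (w₀ := w₀) fun w hw k =>
      hUconst k w hw⟩

end Main

end AffineIsometricAction

theorem mainTheorem7 {𝕜 G H₁ H₂ : Type*} [RCLike 𝕜] [Group G]
    [NormedAddCommGroup H₁] [InnerProductSpace 𝕜 H₁] [CompleteSpace H₁]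
    [NormedAddCommGroup H₂] [InnerProductSpace 𝕜 H₂] [CompleteSpace H₂]
    (α₁ : AffineIsometricAction 𝕜 G H₁) (α₂ : AffineIsometricAction 𝕜 G H₂)
    (h₁ : AffineIsometricAction.IsIrreducible α₁)
    (h₂ : AffineIsometricAction.IsIrreducible α₂) :
    AffineIsometricAction.IsReducible (AffineIsometricAction.directSum α₁ α₂) ↔
      ∃ (V₁ : AffineIsometricAction.Subrep α₁) (V₂ : AffineIsometricAction.Subrep α₂),
        V₁.carrier ≠ ⊥ ∧ V₂.carrier ≠ ⊥ ∧
        AffineIsometricAction.Equivalent V₁.projectedAction V₂.projectedAction :=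
  ⟨AffineIsometricAction.exists_equivalent_of_isReducible_directSum h₁ h₂,
    fun ⟨V₁, V₂, _, hV₂, h⟩ =>
      AffineIsometricAction.isReducible_directSum_of_equivalent V₁ V₂ hV₂ h⟩
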